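/- All topological spaces are Hausdorff. A paratopological group is a group $G$ with a topology for which the multiplication $G\times G\to G$ is continuous. For such $G$, let $G^\flat$ (the group reflexion) denote the group $G$ with the strongest group topology (not required to be Hausdorff) that is weaker than the topology of $G$; sets closed in $G^\flat$ are called $\flat$-closed. $G$ is called: saturated if $U^{-1}$ has non-empty interior for every non-empty open $U\subset G$; $\flat$-regular if each neighborhood of the unit contains a $\flat$-closed neighborhood of the unit; SIN if each neighborhood $U$ of the unit contains a neighborhood $W$ of the unit with $gWg^{-1}\subset U$ for all $g\in G$; Sorgenfrey if $G$ is non-discrete, saturated and has a neighborhood $U$ of the unit such that for every neighborhood $V$ of the unit there is a neighborhood $W$ of the unit such that $x,y\in V$ for all $x,y\in U$ with $xy\in W$. A continuous map $h:X\to Y$ is regular if for every $x\in X$ and every neighborhood $U$ of $x$ there is a closed $F\subset Y$ such that $h^{-1}(F)$ is a closed neighborhood of $x$ contained in $U$. The character $\chi(X)$ is the smallest infinite cardinal $\kappa$ such that each point of $X$ has a neighborhood base of size $\le\kappa$. A class $\mathcal G$ of topological groups is closed-hereditary if every closed subgroup of a group in $\mathcal G$ is in $\mathcal G$, and $K$-stable,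 for a topological group $K$, if $X\times K\in\mathcal G$ for every $X\in\mathcal G$. A paratopological group $H$ is $\mathcal G$-regular if there is a regular continuous bijective homomorphism from $H$ onto a group in $\mathcal G$. Theorem. Let $T$ be a first-countable, saturated, regular, Sorgenfrey paratopological SIN-group and let $\mathcal G$ be a closed-hereditary, $T^\flat$-stable class of first-countable topological SIN-groups. Then a paratopological group $H$ is $\mathcal G$-regular if and only if $H$ is (topologically isomorphic to) a $\flat$-closed subgroup of a saturated $\flat$-regular paratopological group $G$ such that $G^\flat\in\mathcal G$, $\chi(G)=\chi(H)$ and $|G/H|=|T|$. -/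

import Mathlib

universe u

namespace Paratop

open Topology Pointwise Cardinal

/-! A paratopological group is a group with a topology making the multiplication (jointly)
continuous, i.e. `[Group G] [TopologicalSpace G] [ContinuousMul G]`. -/

/-- Saturated: the inverse of every nonempty open set has nonempty interior. -/
def IsSaturated (G : Type u) [Group G] [TopologicalSpace G] : Prop :=
  ∀ U : Set G, IsOpen U → U.Nonempty → (interior U⁻¹).Nonempty

/-- SIN: every neighborhood `U` of the unit contains a neighborhood `W` of the unit with
`g W g⁻¹ ⊆ U` for all `g`. -/
def IsSIN (G : Type u) [Group G] [TopologicalSpace G] : Prop :=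
  ∀ U ∈ 𝓝 (1 : G), ∃ W ∈ 𝓝 (1 : G), W ⊆ U ∧ ∀ g : G, ∀ w ∈ W, g * w * g⁻¹ ∈ U

/-- Sorgenfrey: non-discrete, saturated, and there is a neighborhood `U` of the unit such that
for every neighborhood `V` of the unit there is a neighborhood `W` of the unit such that
`x, y ∈ V` for all `x, y ∈ U` with `x * y ∈ W`. -/
def IsSorgenfrey (G : Type u) [Group G] [TopologicalSpace G] : Prop :=
  ¬ DiscreteTopology G ∧ IsSaturated G ∧
    ∃ U ∈ 𝓝 (1 : G), ∀ V ∈ 𝓝 (1 : G), ∃ W ∈ 𝓝 (1 : G),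
      ∀ x ∈ U, ∀ y ∈ U, x * y ∈ W → x ∈ V ∧ y ∈ V

/-- The strongest group topology weaker than the given topology of `G`.
(In Mathlib's order on topologies `τ ≤ t` says that `t` is weaker than `τ`.) -/
@[reducible] def reflexionTopology (G : Type u) [Group G] [τ : TopologicalSpace G] : TopologicalSpace G :=
  sInf {t | τ ≤ t ∧ @IsTopologicalGroup G t _}

/-- `reflexionTopology G` is indeed the strongest group topology weaker than the topology
of `G`. -/
theorem reflexionTopology_isLeast (G : Type u) [Group G] [τ : TopologicalSpace G] :
    IsLeast {t : TopologicalSpace G | τ ≤ t ∧ @IsTopologicalGroup G t _}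
      (reflexionTopology G) :=
  ⟨⟨le_sInf fun _ ht => ht.1, topologicalGroup_sInf fun _ ht => ht.2⟩, fun _ ht => sInf_le ht⟩

/-- The group reflexion `G^♭`: the group `G` with the topology `reflexionTopology G`. -/
def Reflexion (G : Type u) : Type u := G

instance (G : Type u) [Group G] : Group (Reflexion G) := inferInstanceAs (Group G)

instance (G : Type u) [Group G] [TopologicalSpace G] : TopologicalSpace (Reflexion G) :=
  reflexionTopology G

/-- `♭`-closed: closed in the topology of the group reflexion. -/
def IsFlatClosed {G : Type u} [Group G] [TopologicalSpace G] (A : Set G) : Prop :=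
  IsClosed[reflexionTopology G] A

/-- `♭`-regular: each neighborhood of the unit contains a `♭`-closed neighborhood of the unit. -/
def IsFlatRegular (G : Type u) [Group G] [TopologicalSpace G] : Prop :=
  ∀ U ∈ 𝓝 (1 : G), ∃ F ∈ 𝓝 (1 : G), F ⊆ U ∧ IsFlatClosed F

/-- Regular map: for each point `x` and each neighborhood `U` of `x` there is a closed subset `F`
of the codomain whose preimage is a closed neighborhood of `x` contained in `U`. -/
def IsRegularMap {X Y : Type u} [TopologicalSpace X] [TopologicalSpace Y] (h : X → Y) : Prop :=
  ∀ x : X, ∀ U ∈ 𝓝 x, ∃ F : Set Y,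
    IsClosed F ∧ IsClosed (h ⁻¹' F) ∧ h ⁻¹' F ∈ 𝓝 x ∧ h ⁻¹' F ⊆ U

/-- The character: the smallest infinite cardinal `κ` such that each point has a neighborhood
base of size at most `κ`. -/
noncomputable def character (X : Type u) [TopologicalSpace X] : Cardinal.{u} :=
  sInf {κ | ℵ₀ ≤ κ ∧ ∀ x : X, ∃ B : Set (Set X), #B ≤ κ ∧ (𝓝 x).HasBasis (· ∈ B) id}

/-- Each member of the class `𝒢` is a Hausdorff first-countable topological SIN-group. -/
def IsClassOfFirstCountableSINGroups
    (𝒢 : ∀ (X : Type u) [Group X] [TopologicalSpace X], Prop) : Prop :=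
  ∀ (X : Type u) [Group X] [TopologicalSpace X], 𝒢 X →
    IsTopologicalGroup X ∧ T2Space X ∧ FirstCountableTopology X ∧ IsSIN X

/-- Closed-hereditary: each closed subgroup of a member of `𝒢` belongs to `𝒢`. -/
def IsClosedHereditary (𝒢 : ∀ (X : Type u) [Group X] [TopologicalSpace X], Prop) : Prop :=
  ∀ (X : Type u) [Group X] [TopologicalSpace X], 𝒢 X →
    ∀ S : Subgroup X, IsClosed (S : Set X) → 𝒢 S

/-- `K`-stable: `X × K` belongs to `𝒢` for each `X` in `𝒢`. -/
def IsStable (𝒢 : ∀ (X : Type u) [Group X] [TopologicalSpace X], Prop)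
    (K : Type u) [Group K] [TopologicalSpace K] : Prop :=
  ∀ (X : Type u) [Group X] [TopologicalSpace X], 𝒢 X → 𝒢 (X × K)

/-- `𝒢`-regular: there is a regular continuous bijective homomorphism onto a member of `𝒢`. -/
def IsClassRegular (𝒢 : ∀ (X : Type u) [Group X] [TopologicalSpace X], Prop)
    (H : Type u) [Group H] [TopologicalSpace H] : Prop :=
  ∃ (K : Type u) (_ : Group K) (_ : TopologicalSpace K) (h : H →* K),
    𝒢 K ∧ Continuous h ∧ Function.Bijective h ∧ IsRegularMap h

end Paratop

open Paratop Cardinal Topology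

/-! Write `L` for the group reflexion of `T`. A suitable neighborhood of the unit of `T`, closed up
in `L`, is a cone `C ⊆ L` resembling `[0, ∞) ⊆ ℝ`: it is closed under small products, and if
`x, y ∈ C` and `x * y` is small, then so are `x` and `y`. Given a regular bijection `h : H → K` onto
a member of the class, the group `K × L` is topologized by the neighborhoods of the unit
consisting of all `(x, y)` with `y ∈ C` small and `x ∈ h(F) * V k`, where `k → ∞` as `y → 1`. On the
slice `y = 1` only the intersection of the sets `h(F) * V k` matters, and this is the closure of
`h(F)`; as `h` is regular, the slice is a copy of `H`. Off the slice, each of these neighborhoods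
has interior points in `K × L`, and this forces the group reflexion to be `K × L`.

Conversely, a `♭`-regular group maps regularly onto its group reflexion, and this restricts to
subgroups. -/

namespace Paratop

open Filter Function Set Topology Pointwise Cardinal

section NhdsOne

variable {G L : Type*} [Group G] [TopologicalSpace G] [ContinuousMul G]
  [Group L] [TopologicalSpace L] [ContinuousMul L]

theorem nhds_eq_comap_inv_mul (a : G) : 𝓝 a = comap (a⁻¹ * ·) (𝓝 1) := by
  simpa using (Homeomorph.mulLeft a⁻¹).isInducing.nhds_eq_comap a

theorem continuous_of_tendsto_nhds_one (f : G →* L) (hf : Tendsto f (𝓝 1) (𝓝 1)) :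
    Continuous f := by
  refine continuous_iff_continuousAt.2 fun a => ?_
  rw [ContinuousAt, nhds_eq_comap_inv_mul a, nhds_eq_comap_inv_mul (f a), tendsto_comap_iff]
  exact (hf.comp tendsto_comap).congr fun x => by simp

theorem isInducing_of_nhds_one_eq_comap (f : G →* L) (hf : 𝓝 (1 : G) = comap f (𝓝 1)) :
    IsInducing f := by
  refine isInducing_iff_nhds.2 fun a => ?_
  rw [nhds_eq_comap_inv_mul a, nhds_eq_comap_inv_mul (f a), hf, comap_comap, comap_comap]
  congr 1
  ext x
  simp

end NhdsOne

section Reflexion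

variable {G : Type u} [Group G]

/-- The identity of `G`, as an isomorphism onto the group reflexion. -/
def toReflexion (G : Type u) [Group G] : G ≃* Reflexion G := MulEquiv.refl G

variable [TopologicalSpace G]

instance : IsTopologicalGroup (Reflexion G) := (reflexionTopology_isLeast G).1.2

theorem continuous_toReflexion : Continuous (toReflexion G) :=
  continuous_id_iff_le.2 (reflexionTopology_isLeast G).1.1

theorem not_discreteTopology_reflexion (hG : ¬ DiscreteTopology G) :
    ¬ DiscreteTopology (Reflexion G) := fun _ =>
  hG (.of_continuous_injective continuous_toReflexion (toReflexion G).injective)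

end Reflexion

/-- Invariance of a set under all inner automorphisms. -/
def IsConjInvariant {G : Type*} [Group G] (V : Set G) : Prop :=
  ∀ g, ∀ x ∈ V, g * x * g⁻¹ ∈ V

theorem IsConjInvariant.conj_mem_iff {G : Type*} [Group G] {V : Set G} (hV : IsConjInvariant V)
    (g : G) {x : G} : g * x * g⁻¹ ∈ V ↔ x ∈ V :=
  ⟨fun hx => by simpa [mul_assoc] using hV g⁻¹ _ hx, hV g x⟩

section SIN

variable {G : Type u} [Group G] [TopologicalSpace G]

theorem IsSIN.hasBasis_nhds_one (hG : IsSIN G) :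
    (𝓝 (1 : G)).HasBasis (fun V => V ∈ 𝓝 1 ∧ IsConjInvariant V) id := by
  refine hasBasis_self.2 fun U hU => ?_
  obtain ⟨W, hW, -, hWU⟩ := hG U hU
  refine ⟨{x | ∀ g, g * x * g⁻¹ ∈ U}, mem_of_superset hW fun w hw g => hWU g w hw,
    fun g x hx k => ?_, fun x hx => by simpa using hx 1⟩
  simpa only [mul_inv_rev, mul_assoc] using hx (k * g)

theorem IsSIN.exists_isConjInvariant_mul_subset [ContinuousMul G] (hG : IsSIN G) {U : Set G}
    (hU : U ∈ 𝓝 1) : ∃ V ∈ 𝓝 (1 : G), IsConjInvariant V ∧ V * V ⊆ U := by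
  obtain ⟨O, hO, hO_one, hOU⟩ := exists_open_nhds_one_mul_subset hU
  obtain ⟨V, ⟨hV, hV_inv⟩, hVO⟩ := hG.hasBasis_nhds_one.mem_iff.1 (hO.mem_nhds hO_one)
  exact ⟨V, hV, hV_inv, (mul_subset_mul hVO hVO).trans hOU⟩

theorem IsSIN.of_isInducing {L : Type u} [Group L] [TopologicalSpace L] (hG : IsSIN G)
    (f : L →* G) (hf : IsInducing f) : IsSIN L := by
  have nhds_one : 𝓝 (1 : L) = comap f (𝓝 1) := by rw [hf.nhds_eq_comap, map_one]
  intro U hU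
  obtain ⟨V, ⟨hV, hV_inv⟩, hVU⟩ := ((hG.hasBasis_nhds_one.comap f).mem_iff).1 (nhds_one ▸ hU)
  refine ⟨f ⁻¹' V, nhds_one ▸ preimage_mem_comap hV, hVU, fun g w hw => hVU ?_⟩
  simpa only [mem_preimage, id, map_mul, map_inv] using hV_inv (f g) (f w) hw

/-- The group filter basis of all sets `U / U` for `U` a neighborhood of the unit. Its topology
is the topology of the group reflexion of a paratopological SIN-group. -/
abbrev IsSIN.groupFilterBasis [ContinuousMul G] (hG : IsSIN G) : GroupFilterBasis G where
  sets := (fun U : Set G => U / U) '' (𝓝 1).sets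
  nonempty := ⟨_, univ, univ_mem, rfl⟩
  inter_sets := by
    rintro _ _ ⟨U, hU, rfl⟩ ⟨V, hV, rfl⟩
    exact ⟨_, ⟨_, inter_mem hU hV, rfl⟩, subset_inter
      (div_subset_div inter_subset_left inter_subset_left)
      (div_subset_div inter_subset_right inter_subset_right)⟩
  one' := by
    rintro _ ⟨U, hU, rfl⟩
    exact one_mem_div_iff.2 (not_disjoint_iff.2 ⟨1, mem_of_mem_nhds hU, mem_of_mem_nhds hU⟩)
  mul' := by
    rintro _ ⟨U, hU, rfl⟩
    obtain ⟨V, hV, hV_inv, hVU⟩ := hG.exists_isConjInvariant_mul_subset hU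
    refine ⟨_, ⟨V, hV, rfl⟩, ?_⟩
    rintro _ ⟨_, ⟨a, ha, b, hb, rfl⟩, _, ⟨c, hc, d, hd, rfl⟩, rfl⟩
    refine ⟨a * c, hVU (mul_mem_mul ha hc), d * (c⁻¹ * b * c⁻¹⁻¹),
      hVU (mul_mem_mul hd (hV_inv c⁻¹ b hb)), ?_⟩
    simp only [div_eq_mul_inv]
    group
  inv' := by
    rintro _ ⟨U, hU, rfl⟩
    exact ⟨_, ⟨U, hU, rfl⟩, (inv_div U U).ge⟩
  conj' := by
    rintro g _ ⟨U, hU, rfl⟩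
    obtain ⟨V, ⟨hV, hV_inv⟩, hVU⟩ := hG.hasBasis_nhds_one.mem_iff.1 hU
    refine ⟨_, ⟨V, hV, rfl⟩, ?_⟩
    rintro _ ⟨a, ha, b, hb, rfl⟩
    refine ⟨_, hVU (hV_inv g a ha), _, hVU (hV_inv g b hb), ?_⟩
    simp only [div_eq_mul_inv]
    group

theorem IsSIN.image_div_mem_nhds_reflexion [ContinuousMul G] (hG : IsSIN G) {U : Set G}
    (hU : U ∈ 𝓝 1) : toReflexion G '' (U / U) ∈ 𝓝 1 := by
  have topology_le : ‹TopologicalSpace G› ≤ hG.groupFilterBasis.topology := by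
    refine le_of_nhds_le_nhds fun a => ?_
    refine (hG.groupFilterBasis.nhds_hasBasis a).ge_iff.2 ?_
    rintro _ ⟨V, hV, rfl⟩
    refine mem_of_superset (smul_mem_nhds_self.2 hV) (image_mono fun v hv => ?_)
    exact ⟨v, hv, 1, mem_of_mem_nhds hV, div_one v⟩
  have reflexion_le : reflexionTopology G ≤ hG.groupFilterBasis.topology :=
    (reflexionTopology_isLeast G).2 ⟨topology_le, hG.groupFilterBasis.isTopologicalGroup⟩
  rw [show toReflexion G '' (U / U) = U / U from image_id _]
  exact nhds_mono reflexion_le (hG.groupFilterBasis.mem_nhds_one ⟨U, hU, rfl⟩)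

end SIN

/-- Feebly open maps: the image of every nonempty open set has nonempty interior. -/
def IsFeeblyOpen {X Y : Type*} [TopologicalSpace X] [TopologicalSpace Y] (f : X → Y) : Prop :=
  ∀ U : Set X, IsOpen U → U.Nonempty → (interior (f '' U)).Nonempty

section FeeblyOpen

theorem isFeeblyOpen_of_nhds_one {G L : Type*} [Group G] [TopologicalSpace G] [ContinuousMul G]
    [Group L] [TopologicalSpace L] [ContinuousMul L] (f : G →* L)
    (hf : ∀ U ∈ 𝓝 (1 : G), (interior (f '' U)).Nonempty) : IsFeeblyOpen f := by
  rintro U hU ⟨a, ha⟩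
  have image_eq : f '' U = f a • f '' (a⁻¹ • U) := by
    rw [← image_smul_distrib, smul_inv_smul]
  rw [image_eq, interior_smul]
  exact (hf _ (by simpa using smul_mem_nhds_smul a⁻¹ (hU.mem_nhds ha))).smul_set

theorem IsSaturated.isFeeblyOpen_toReflexion {T : Type u} [Group T] [TopologicalSpace T]
    [ContinuousMul T] (hT : IsSaturated T) (hT_sin : IsSIN T) : IsFeeblyOpen (toReflexion T) := by
  refine isFeeblyOpen_of_nhds_one (toReflexion T).toMonoidHom fun U hU => ?_
  obtain ⟨V, hV, hV_one, hVU⟩ := exists_open_nhds_one_mul_subset hU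
  obtain ⟨c, hc⟩ := hT V hV ⟨1, hV_one⟩
  have cV_mem : {w | c * w ∈ V⁻¹} ∈ 𝓝 (1 : T) :=
    (continuous_const_mul c).continuousAt.preimage_mem_nhds
      (by simpa using mem_interior_iff_mem_nhds.1 hc)
  have W_mem := hT_sin.image_div_mem_nhds_reflexion (inter_mem (hV.mem_nhds hV_one) cV_mem)
  refine ⟨toReflexion T c⁻¹, mem_interior_iff_mem_nhds.2 <|
    mem_of_superset (mul_singleton_mem_nhds_of_nhds_one _ W_mem) ?_⟩
  rintro _ ⟨_, ⟨_, ⟨w, hw, w', hw', rfl⟩, rfl⟩, _, rfl, rfl⟩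
  exact ⟨w * (c * w')⁻¹, hVU (mul_mem_mul hw.1 hw'.2), by simp [div_eq_mul_inv, mul_assoc]⟩

variable {G L : Type u} [Group G] [TopologicalSpace G]
  [Group L] [TopologicalSpace L] [IsTopologicalGroup L] {e : G ≃* L}

theorem IsFeeblyOpen.isSaturated (he : IsFeeblyOpen e) (he_cont : Continuous e) :
    IsSaturated G := by
  intro U hU hU_ne
  obtain ⟨b, hb⟩ := he U hU hU_ne
  have preimage_subset : e ⁻¹' (interior (e '' U))⁻¹ ⊆ U⁻¹ := fun x hx => by
    obtain ⟨u, hu, hux⟩ := interior_subset hx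
    rwa [e.injective (hux.trans (map_inv e x).symm)] at hu
  exact ⟨e.symm b⁻¹, mem_interior.2 ⟨_, preimage_subset, isOpen_interior.inv.preimage he_cont,
    by simpa using hb⟩⟩

theorem IsFeeblyOpen.reflexionTopology_eq (he : IsFeeblyOpen e) (he_cont : Continuous e) :
    reflexionTopology G = .induced e ‹_› := by
  refine le_antisymm ((reflexionTopology_isLeast G).2
    ⟨he_cont.le_induced, topologicalGroup_induced e⟩) ?_
  let φ : L ≃* Reflexion G := e.symm.trans (toReflexion G)
  have φ_comp : φ ∘ e = toReflexion G := funext fun x => by simp [φ]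
  have φ_tendsto : Tendsto φ (𝓝 1) (𝓝 1) := by
    intro s hs
    obtain ⟨V, hV, hVs⟩ := exists_nhds_split_inv hs
    have preimage_mem : toReflexion G ⁻¹' V ∈ 𝓝 (1 : G) :=
      continuous_toReflexion.continuousAt.preimage_mem_nhds (by simpa using hV)
    let O : Set L := interior (e '' interior (toReflexion G ⁻¹' V))
    obtain ⟨b, hb⟩ : O.Nonempty :=
      he _ isOpen_interior ⟨1, mem_interior_iff_mem_nhds.2 preimage_mem⟩
    have φ_mem : ∀ x ∈ O, φ x ∈ V := by
      intro x hx
      obtain ⟨y, hy, rfl⟩ := interior_subset hx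
      have ey_mem : toReflexion G y ∈ V := interior_subset (s := toReflexion G ⁻¹' V) hy
      simpa [φ] using ey_mem
    have div_mem : O / O ∈ 𝓝 1 :=
      isOpen_interior.div_left.mem_nhds (one_mem_div_iff.2 (not_disjoint_iff.2 ⟨b, hb, hb⟩))
    refine mem_map.2 (mem_of_superset div_mem ?_)
    rintro _ ⟨x, hx, y, hy, rfl⟩
    simpa only [mem_preimage, map_div] using hVs _ (φ_mem x hx) _ (φ_mem y hy)
  have φ_cont : Continuous φ := continuous_of_tendsto_nhds_one φ.toMonoidHom φ_tendsto
  calc TopologicalSpace.induced e ‹_› ≤ .induced e (.induced φ inferInstance) :=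
        induced_mono φ_cont.le_induced
    _ = .induced (toReflexion G) inferInstance := by rw [induced_compose, φ_comp]
    _ = reflexionTopology G := induced_id (t := reflexionTopology G)

end FeeblyOpen

/-- An abstraction of the trace of the one-sided neighborhoods of a Sorgenfrey group on its group
reflexion; the model case is the half-line `[0, ∞)` in the real line. -/
structure IsSorgenfreyCone {L : Type*} [Group L] [TopologicalSpace L] (C : Set L) : Prop where
  isConjInvariant : IsConjInvariant C
  one_mem_closure_interior : 1 ∈ closure (interior C)
  exists_nhds_mul_subset : ∃ U ∈ 𝓝 (1 : L), (C ∩ U) * (C ∩ U) ⊆ C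
  exists_nhds_factor : ∀ U ∈ 𝓝 (1 : L), ∃ W ∈ 𝓝 (1 : L),
    ∀ x ∈ C, ∀ y ∈ C, x * y ∈ W → x ∈ U ∧ y ∈ U

section SorgenfreyCone

theorem IsSorgenfreyCone.closure {L : Type*} [Group L] [TopologicalSpace L] [IsTopologicalGroup L]
    {C : Set L} (hC : IsSorgenfreyCone C) : IsSorgenfreyCone (closure C) where
  isConjInvariant g x hx :=
    map_mem_closure (f := (g * · * g⁻¹)) (by fun_prop) hx (hC.isConjInvariant g)
  one_mem_closure_interior :=
    closure_mono (interior_mono subset_closure) hC.one_mem_closure_interior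
  exists_nhds_mul_subset := by
    obtain ⟨U, hU, hUC⟩ := hC.exists_nhds_mul_subset
    refine ⟨interior U, interior_mem_nhds.2 hU, ?_⟩
    have subset_closure_inter : _root_.closure C ∩ interior U ⊆ _root_.closure (C ∩ U) :=
      isOpen_interior.closure_inter.trans
        (closure_mono (inter_subset_inter_right C interior_subset))
    rintro _ ⟨x, hx, y, hy, rfl⟩
    exact map_mem_closure₂ continuous_mul (subset_closure_inter hx) (subset_closure_inter hy)
      fun a ha b hb => hUC (mul_mem_mul ha hb)
  exists_nhds_factor U hU := by
    obtain ⟨F, hF, hF_closed, hFU⟩ := exists_mem_nhds_isClosed_subset hU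
    obtain ⟨W, hW, hWF⟩ := hC.exists_nhds_factor F hF
    refine ⟨interior W, interior_mem_nhds.2 hW, fun x hx y hy hxy => ?_⟩
    have mem_closure : (x, y) ∈ _root_.closure (C ×ˢ C) := by
      rw [closure_prod_eq]
      exact ⟨hx, hy⟩
    have mul_preimage_open : IsOpen {p : L × L | p.1 * p.2 ∈ interior W} :=
      isOpen_interior.preimage continuous_mul
    have xy_mem : (x, y) ∈ F ×ˢ F :=
      closure_minimal (fun p hp => hWF _ hp.2.1 _ hp.2.2 (interior_subset hp.1))
        (hF_closed.prod hF_closed) (mul_preimage_open.inter_closure ⟨hxy, mem_closure⟩)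
    exact ⟨hFU xy_mem.1, hFU xy_mem.2⟩

variable {T : Type u} [Group T] [TopologicalSpace T] [ContinuousMul T]

theorem IsSorgenfrey.exists_nhds_reflexion_factor (hT : IsSorgenfrey T) (hT_sin : IsSIN T) :
    ∃ U ∈ 𝓝 (1 : T), IsConjInvariant U ∧ ∀ V ∈ 𝓝 (1 : T), ∃ N ∈ 𝓝 (1 : Reflexion T),
      ∀ x ∈ U, ∀ y ∈ U, toReflexion T (x * y) ∈ N → x ∈ V ∧ y ∈ V := by
  obtain ⟨-, -, U₀, hU₀, factor⟩ := hT
  obtain ⟨U, hU, hU_inv, hUU⟩ := hT_sin.exists_isConjInvariant_mul_subset hU₀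
  have subset_mul : U ⊆ U * U := subset_mul_left U (mem_of_mem_nhds hU)
  refine ⟨U, hU, hU_inv, fun V hV => ?_⟩
  obtain ⟨V', hV', hV'V⟩ := factor V hV
  obtain ⟨W, hW, hWV⟩ := factor (V' ∩ V) (inter_mem hV' hV)
  refine ⟨_, hT_sin.image_div_mem_nhds_reflexion (inter_mem hW hU), ?_⟩
  rintro x hx y hy ⟨_, ⟨a, ha, b, hb, rfl⟩, hab⟩
  -- If `x * y = a / b` then `x * (y * b) = a` is a product of elements of `U₀`.
  have mul_eq : x * (y * b) = a := by
    rw [← mul_assoc, ← (toReflexion T).injective hab]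
    exact div_mul_cancel a b
  obtain ⟨hxV, hyb⟩ := hWV x (hUU (subset_mul hx)) (y * b) (hUU (mul_mem_mul hy hb.2))
    (mul_eq ▸ ha.1)
  exact ⟨hxV.2, (hV'V y (hUU (subset_mul hy)) b (hUU (subset_mul hb.2)) hyb.1).1⟩

theorem IsSorgenfrey.exists_isSorgenfreyCone (hT : IsSorgenfrey T) (hT_sin : IsSIN T) :
    ∃ C : Set (Reflexion T), IsSorgenfreyCone C := by
  obtain ⟨U, hU, hU_inv, factor⟩ := hT.exists_nhds_reflexion_factor hT_sin
  refine ⟨toReflexion T '' U, ?_, ?_, ?_, fun N hN => ?_⟩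
  · rintro g _ ⟨x, hx, rfl⟩
    exact ⟨_, hU_inv ((toReflexion T).symm g) x hx, by simp⟩
  · refine mem_closure_iff_nhds.2 fun N hN => ?_
    have inter_mem_nhds : U ∩ toReflexion T ⁻¹' N ∈ 𝓝 (1 : T) :=
      inter_mem hU (continuous_toReflexion.continuousAt.preimage_mem_nhds (by simpa using hN))
    obtain ⟨z, hz⟩ := hT.2.1.isFeeblyOpen_toReflexion hT_sin _ isOpen_interior
      ⟨1, mem_interior_iff_mem_nhds.2 inter_mem_nhds⟩
    refine ⟨z, ?_, interior_mono (image_mono (interior_subset.trans inter_subset_left)) hz⟩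
    obtain ⟨x, hx, rfl⟩ := interior_subset hz
    exact (interior_subset hx).2
  · obtain ⟨V, hV, hV_one, hVU⟩ := exists_open_nhds_one_mul_subset hU
    obtain ⟨N, hN, hNV⟩ := factor V (hV.mem_nhds hV_one)
    have mem_V : ∀ x ∈ U, toReflexion T x ∈ N → x ∈ V := fun x hx hxN =>
      (hNV x hx 1 (mem_of_mem_nhds hU) (by rwa [mul_one])).1
    refine ⟨N, hN, ?_⟩
    rintro _ ⟨_, ⟨⟨x, hx, rfl⟩, hxN⟩, _, ⟨⟨y, hy, rfl⟩, hyN⟩, rfl⟩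
    exact ⟨x * y, hVU (mul_mem_mul (mem_V x hx hxN) (mem_V y hy hyN)), map_mul _ x y⟩
  · obtain ⟨W, hW, hWN⟩ := factor (toReflexion T ⁻¹' N)
      (continuous_toReflexion.continuousAt.preimage_mem_nhds (by simpa using hN))
    refine ⟨W, hW, ?_⟩
    rintro _ ⟨x, hx, rfl⟩ _ ⟨y, hy, rfl⟩ hxy
    exact hWN x hx y hy (by rwa [map_mul])

end SorgenfreyCone

section InvariantBasis

/-- A decreasing neighborhood basis of the unit by conjugation-invariant sets, each of which
contains the square of its successor. -/
structure IsInvariantBasis {G : Type*} [Group G] [TopologicalSpace G] (V : ℕ → Set G) : Prop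
    extends (𝓝 (1 : G)).HasAntitoneBasis V where
  isConjInvariant : ∀ n, IsConjInvariant (V n)
  mul_subset : ∀ n, V (n + 1) * V (n + 1) ⊆ V n

namespace IsInvariantBasis

variable {G : Type*} [Group G] [TopologicalSpace G] {V : ℕ → Set G}

theorem mem_nhds (hV : IsInvariantBasis V) (n : ℕ) : V n ∈ 𝓝 1 :=
  hV.toHasAntitoneBasis.mem n

theorem one_mem (hV : IsInvariantBasis V) (n : ℕ) : (1 : G) ∈ V n :=
  mem_of_mem_nhds (hV.mem_nhds n)

theorem mul_mem (hV : IsInvariantBasis V) {n : ℕ} {x y : G} (hx : x ∈ V (n + 1))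
    (hy : y ∈ V (n + 1)) : x * y ∈ V n :=
  hV.mul_subset n (mul_mem_mul hx hy)

end IsInvariantBasis

/-- An invariant basis at the unit along which the local conditions in `IsSorgenfreyCone C` hold
uniformly. -/
structure IsInvariantBasis.IsAdapted {L : Type*} [Group L] [TopologicalSpace L] (C : Set L)
    (N : ℕ → Set L) : Prop extends IsInvariantBasis N where
  cone_mul_subset : ∀ n, (C ∩ N (n + 1)) * (C ∩ N (n + 1)) ⊆ C
  factor : ∀ n, ∀ x ∈ C, ∀ y ∈ C, x * y ∈ N (n + 1) → x ∈ N n ∧ y ∈ N n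

theorem eventually_smallSets_mul_subset {G : Type*} [Monoid G] [TopologicalSpace G]
    [ContinuousMul G] {U : Set G} (hU : U ∈ 𝓝 1) : ∀ᶠ W in (𝓝 (1 : G)).smallSets, W * W ⊆ U := by
  obtain ⟨V, hV, hV_one, hVU⟩ := exists_open_nhds_one_mul_subset hU
  exact eventually_smallSets.2 ⟨V, hV.mem_nhds hV_one, fun W hW =>
    (mul_subset_mul hW hW).trans hVU⟩

variable {G : Type u} [Group G] [TopologicalSpace G] [FirstCountableTopology G]

theorem IsSIN.exists_hasAntitoneBasis_rel (hG : IsSIN G) {r : Set G → Set G → Prop}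
    (hr : ∀ U ∈ 𝓝 (1 : G), ∀ᶠ W in (𝓝 1).smallSets, r W U) :
    ∃ V : ℕ → Set G, (𝓝 1).HasAntitoneBasis V ∧ (∀ n, IsConjInvariant (V n)) ∧
      ∀ n, r (V (n + 1)) (V n) := by
  obtain ⟨V, hV_inv, hV⟩ := hG.hasBasis_nhds_one.exists_antitone_subbasis
  obtain ⟨φ, -, hφr, hφ⟩ := hV.subbasis_with_rel fun n =>
    hV.tendsto_smallSets.eventually (hr _ (hV_inv n).1)
  exact ⟨_, hφ, fun n => (hV_inv (φ n)).2, fun n => hφr n.lt_succ_self⟩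

variable [ContinuousMul G]

theorem IsSIN.exists_isInvariantBasis (hG : IsSIN G) :
    ∃ V : ℕ → Set G, IsInvariantBasis V := by
  obtain ⟨V, hV, hV_inv, hV_mul⟩ := hG.exists_hasAntitoneBasis_rel
    fun U hU => eventually_smallSets_mul_subset hU
  exact ⟨V, hV, hV_inv, hV_mul⟩

theorem IsSorgenfreyCone.exists_isAdapted {C : Set G} (hC : IsSorgenfreyCone C) (hG : IsSIN G) :
    ∃ N : ℕ → Set G, IsInvariantBasis.IsAdapted C N := by
  obtain ⟨U₀, hU₀, hU₀C⟩ := hC.exists_nhds_mul_subset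
  have cone_mul : ∀ᶠ W in (𝓝 (1 : G)).smallSets, (C ∩ W) * (C ∩ W) ⊆ C :=
    eventually_smallSets.2 ⟨U₀, hU₀, fun W hW =>
      (mul_subset_mul (inter_subset_inter_right C hW) (inter_subset_inter_right C hW)).trans hU₀C⟩
  have factor : ∀ U ∈ 𝓝 (1 : G), ∀ᶠ W in (𝓝 (1 : G)).smallSets,
      ∀ x ∈ C, ∀ y ∈ C, x * y ∈ W → x ∈ U ∧ y ∈ U := fun U hU =>
    let ⟨W, hW, hWU⟩ := hC.exists_nhds_factor U hU
    eventually_smallSets.2 ⟨W, hW, fun _ hW' x hx y hy hxy => hWU x hx y hy (hW' hxy)⟩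
  obtain ⟨N, hN, hN_inv, hN_rel⟩ := hG.exists_hasAntitoneBasis_rel fun U hU =>
    (eventually_smallSets_mul_subset hU).and (cone_mul.and (factor U hU))
  exact ⟨N, ⟨hN, hN_inv, fun n => (hN_rel n).1⟩, fun n => (hN_rel n).2.1,
    fun n => (hN_rel n).2.2⟩

end InvariantBasis

section TopologyOfNhdsOne

variable {G : Type*} [Group G]

/-- The topology on a group for which the neighborhoods of `a` are the left translates by `a` of
the members of a filter `F`. -/
abbrev topologyOfNhdsOne (F : Filter G) : TopologicalSpace G := .mkOfNhds fun a => a • F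

variable {F : Filter G}

theorem nhds_topologyOfNhdsOne (h_one : 1 ≤ F) (h_mul : F * F ≤ F) (a : G) :
    @nhds G (topologyOfNhdsOne F) a = a • F := by
  refine TopologicalSpace.nhds_mkOfNhds _ a (fun b => ?_) fun b s hs => ?_
  · simpa using! Filter.map_mono (m := (b • ·)) h_one
  · obtain ⟨t, ht, t', ht', htt'⟩ := Filter.mem_mul.1 (h_mul hs)
    refine mem_map.2 (mem_of_superset ht fun x hx => mem_map.2 (mem_of_superset ht' fun y hy => ?_))
    simpa only [mem_preimage, smul_eq_mul, mul_assoc] using htt' (mul_mem_mul hx hy)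

theorem continuousMul_topologyOfNhdsOne (h_one : 1 ≤ F) (h_mul : F * F ≤ F)
    (h_conj : ∀ g : G, map (g * · * g⁻¹) F ≤ F) : @ContinuousMul G (topologyOfNhdsOne F) _ := by
  let _ := topologyOfNhdsOne F
  have nhds_eq := nhds_topologyOfNhdsOne h_one h_mul
  have nhds_one : 𝓝 (1 : G) = F := by rw [nhds_eq, one_smul]
  refine .of_nhds_one ?_ (fun a => ?_) fun a => ?_
  · rw [nhds_one, Tendsto, map_uncurry_prod]
    exact h_mul
  · rw [nhds_one, nhds_eq]
    rfl
  · have conj_eq : map (a * · * a⁻¹) F = F := by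
      refine le_antisymm (h_conj a) ?_
      simpa [map_map, Function.comp_def, mul_assoc] using
        Filter.map_mono (m := (a * · * a⁻¹)) (h_conj a⁻¹)
    rw [nhds_one, nhds_eq]
    nth_rw 2 [← conj_eq]
    simp only [map_map, Function.comp_def, inv_mul_cancel_right]
    rfl

end TopologyOfNhdsOne

/-- The data from which the topology of a twisted product of `K` and `L` is built: a bijection
from `H` onto `K`, a closed cone in `L`, and bases at the units of `K` and `L`. -/
structure TwistDatum (H K L : Type u) [Group H] [TopologicalSpace H] [Group K]
    [TopologicalSpace K] [Group L] [TopologicalSpace L] where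
  hom : H →* K
  V : ℕ → Set K
  C : Set L
  N : ℕ → Set L
  continuous_hom : Continuous hom
  bijective_hom : Bijective hom
  isInvariantBasis : IsInvariantBasis V
  isSorgenfreyCone : IsSorgenfreyCone C
  isClosed_cone : IsClosed C
  isAdapted : IsInvariantBasis.IsAdapted C N

namespace TwistDatum

section Nhd

variable {H K L : Type u} [Group H] [TopologicalSpace H] [Group K] [TopologicalSpace K]
  [Group L] [TopologicalSpace L] (D : TwistDatum H K L) {F F' : Set H} {m n : ℕ}

/-- The basic neighborhoods of the unit in the twisted product. On the slice `K × {1}` this is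
the intersection of all `D.hom '' F * D.V k`; the closer `p.2` is to the unit, the smaller is the
admissible error in `p.1 ∈ D.hom '' F`. -/
def nhd (F : Set H) (n : ℕ) : Set (K × L) :=
  {p | p.2 ∈ D.C ∩ D.N n ∧ ∀ k, p.2 ∈ D.N k → p.1 ∈ D.hom '' F * D.V (k + n)}

variable {D}

theorem nhd_mono (hF : F ⊆ F') (hmn : m ≤ n) : D.nhd F n ⊆ D.nhd F' m := fun _ hp =>
  ⟨⟨hp.1.1, D.isAdapted.antitone hmn hp.1.2⟩, fun k hk =>
    mul_subset_mul (image_mono hF) (D.isInvariantBasis.antitone (by gcongr)) (hp.2 k hk)⟩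

theorem one_mem_nhd (hF : 1 ∈ F) (n : ℕ) : 1 ∈ D.nhd F n := by
  refine ⟨⟨?_, D.isAdapted.one_mem n⟩, fun k _ =>
    ⟨1, ⟨1, hF, map_one D.hom⟩, 1, D.isInvariantBasis.one_mem _, mul_one 1⟩⟩
  exact D.isClosed_cone.closure_interior_subset D.isSorgenfreyCone.one_mem_closure_interior

theorem nhd_mul_nhd_subset (hF : F * F ⊆ F') : D.nhd F (n + 2) * D.nhd F (n + 2) ⊆ D.nhd F' n := by
  rintro _ ⟨p, hp, q, hq, rfl⟩
  refine ⟨⟨D.isAdapted.cone_mul_subset _ (mul_mem_mul hp.1 hq.1),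
    D.isAdapted.antitone n.le_succ (D.isAdapted.mul_mem hp.1.2 hq.1.2)⟩, fun k hk => ?_⟩
  obtain ⟨j, hkj, hpj, hqj⟩ : ∃ j, k ≤ j + 1 ∧ p.2 ∈ D.N j ∧ q.2 ∈ D.N j := by
    cases k with
    | zero => exact ⟨n + 2, zero_le, hp.1.2, hq.1.2⟩
    | succ j => exact ⟨j, le_rfl, D.isAdapted.factor j _ hp.1.1 _ hq.1.1 hk⟩
  obtain ⟨_, ⟨f, hf, rfl⟩, v, hv, hfv⟩ := hp.2 j hpj
  obtain ⟨_, ⟨g, hg, rfl⟩, w, hw, hgw⟩ := hq.2 j hqj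
  have conj_mem := D.isInvariantBasis.isConjInvariant _ (D.hom g)⁻¹ v hv
  refine ⟨_, ⟨f * g, hF (mul_mem_mul hf hg), rfl⟩, _, D.isInvariantBasis.antitone
    (by omega : k + n ≤ j + n + 1) (D.isInvariantBasis.mul_mem conj_mem hw), ?_⟩
  simp only [Prod.fst_mul, ← hfv, ← hgw, map_mul]
  group

theorem conj_mem_nhd {g : H} (hF : ∀ x ∈ F, g * x * g⁻¹ ∈ F') {p : K × L} (hp : p ∈ D.nhd F n)
    (b : L) : (D.hom g, b) * p * (D.hom g, b)⁻¹ ∈ D.nhd F' n := by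
  refine ⟨⟨D.isSorgenfreyCone.isConjInvariant b _ hp.1.1,
    D.isAdapted.isConjInvariant n b _ hp.1.2⟩, fun k hk => ?_⟩
  obtain ⟨_, ⟨f, hf, rfl⟩, v, hv, hfv⟩ :=
    hp.2 k (((D.isAdapted.isConjInvariant k).conj_mem_iff b).1 hk)
  refine ⟨_, ⟨_, hF f hf, rfl⟩, _, D.isInvariantBasis.isConjInvariant _ (D.hom g) v hv, ?_⟩
  simp only [Prod.fst_mul, Prod.fst_inv, ← hfv, map_mul, map_inv]
  group

theorem nhd_preimage_subset (n : ℕ) :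
    D.nhd (D.hom ⁻¹' D.V (n + 1)) (n + 1) ⊆ D.V n ×ˢ D.N n := by
  intro p hp
  refine ⟨?_, D.isAdapted.antitone n.le_succ hp.1.2⟩
  obtain ⟨_, ⟨f, hf, rfl⟩, v, hv, hfv⟩ := hp.2 (n + 1) hp.1.2
  exact hfv ▸ D.isInvariantBasis.mul_mem hf (D.isInvariantBasis.antitone (by omega) hv)

theorem interior_nhd_nonempty [ContinuousMul L] [T2Space L] (hL : ¬ DiscreteTopology L)
    (hF : 1 ∈ F) (n : ℕ) : (interior (D.nhd F n)).Nonempty := by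
  let O : Set L := interior (D.N n) ∩ interior D.C
  have O_open : IsOpen O := isOpen_interior.inter isOpen_interior
  obtain ⟨b, hbO, hb_one⟩ : ∃ b ∈ O, b ≠ 1 := by
    by_contra! h
    have O_ne : O.Nonempty :=
      mem_closure_iff_nhds.1 D.isSorgenfreyCone.one_mem_closure_interior _
        (interior_mem_nhds.2 (D.isAdapted.mem_nhds n))
    have O_eq : O = {1} := eq_singleton_iff_nonempty_unique_mem.2 ⟨O_ne, h⟩
    exact hL (discreteTopology_of_isOpen_singleton_one (O_eq ▸ O_open))
  obtain ⟨u, v, hu, hv, hbu, hv_one, huv⟩ := t2_separation hb_one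
  obtain ⟨l, hlv⟩ := D.isAdapted.mem_iff.1 (hv.mem_nhds hv_one)
  refine ⟨(1, b), mem_interior_iff_mem_nhds.2 <| mem_of_superset
    (prod_mem_nhds (D.isInvariantBasis.mem_nhds (l + n)) ((O_open.inter hu).mem_nhds ⟨hbO, hbu⟩))
    fun p hp => ⟨⟨interior_subset hp.2.1.2, interior_subset hp.2.1.1⟩, fun k hk => ?_⟩⟩
  have k_le : k ≤ l := by
    by_contra! h
    exact disjoint_left.1 huv hp.2.2 (hlv (D.isAdapted.antitone h.le hk))
  exact ⟨1, ⟨1, hF, map_one D.hom⟩, p.1, D.isInvariantBasis.antitone (by gcongr) hp.1, one_mul p.1⟩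

theorem closure_nhd_subset [IsTopologicalGroup K] [IsTopologicalGroup L] :
    closure (D.nhd F (n + 2)) ⊆ D.nhd F n := by
  intro p hp
  have exists_approx (m : ℕ) : ∃ q ∈ D.nhd F (n + 2),
      q⁻¹ * p ∈ D.V m ×ˢ D.N m ∧ p⁻¹ * q ∈ D.V m ×ˢ D.N m := by
    have box_mem : D.V m ×ˢ D.N m ∈ 𝓝 (1 : K × L) :=
      prod_mem_nhds (D.isInvariantBasis.mem_nhds m) (D.isAdapted.mem_nhds m)
    have inv_mul_mem : ∀ᶠ q in 𝓝 p, q⁻¹ * p ∈ D.V m ×ˢ D.N m :=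
      (by fun_prop : Continuous (·⁻¹ * p)).continuousAt.eventually_mem (by rwa [inv_mul_cancel])
    have mul_mem : ∀ᶠ q in 𝓝 p, p⁻¹ * q ∈ D.V m ×ˢ D.N m :=
      (continuous_const_mul p⁻¹).continuousAt.eventually_mem (by rwa [inv_mul_cancel])
    obtain ⟨q, hq, hqD⟩ := mem_closure_iff_nhds.1 hp _ (inv_mul_mem.and mul_mem)
    exact ⟨q, hqD, hq⟩
  refine ⟨⟨?_, ?_⟩, fun k hk => ?_⟩
  · exact closure_minimal (fun q hq => hq.1.1) (D.isClosed_cone.preimage continuous_snd) hp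
  · obtain ⟨q, hq, ⟨-, hqN⟩, -⟩ := exists_approx (n + 2)
    rw [← mul_inv_cancel_left q.2 p.2]
    exact D.isAdapted.antitone n.le_succ (D.isAdapted.mul_mem hq.1.2 hqN)
  · obtain ⟨q, hq, ⟨hqV, -⟩, -, hqN⟩ := exists_approx (k + n + 2)
    obtain ⟨j, hkj, hqj⟩ : ∃ j, k ≤ j + 1 ∧ q.2 ∈ D.N j := by
      cases k with
      | zero => exact ⟨n + 2, zero_le, hq.1.2⟩
      | succ j =>
        rw [← mul_inv_cancel_left p.2 q.2]
        exact ⟨j, le_rfl, D.isAdapted.mul_mem hk (D.isAdapted.antitone (by omega) hqN)⟩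
    obtain ⟨f, hf, v, hv, hfv⟩ := hq.2 j hqj
    refine ⟨f, hf, v * (q.1⁻¹ * p.1), D.isInvariantBasis.mul_mem
      (D.isInvariantBasis.antitone (by omega) hv) (D.isInvariantBasis.antitone (by omega) hqV), ?_⟩
    simp only at hfv ⊢
    rw [← mul_assoc, hfv, mul_inv_cancel_left]

end Nhd

end TwistDatum

/-- The product group of `K` and `L`, endowed with the paratopological group topology whose
neighborhoods of the unit are generated by the sets `D.nhd F n`. -/
def TwistedProduct {H K L : Type u} [Group H] [TopologicalSpace H] [Group K] [TopologicalSpace K]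
    [Group L] [TopologicalSpace L] (_D : TwistDatum H K L) : Type u := K × L

namespace TwistedProduct

variable {H K L : Type u} [Group H] [TopologicalSpace H] [Group K] [TopologicalSpace K]
  [Group L] [TopologicalSpace L] {D : TwistDatum H K L}

instance : Group (TwistedProduct D) := inferInstanceAs (Group (K × L))

/-- The identity, as an isomorphism from the twisted product onto the product group. -/
def toProd (D : TwistDatum H K L) : TwistedProduct D ≃* K × L := MulEquiv.refl _

theorem isBasis_nhd (D : TwistDatum H K L) :
    IsBasis (fun q : Set H × ℕ => q.1 ∈ 𝓝 1) fun q => toProd D ⁻¹' D.nhd q.1 q.2 where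
  nonempty := ⟨(univ, 0), univ_mem⟩
  inter {q r} hq hr := ⟨(q.1 ∩ r.1, max q.2 r.2), inter_mem hq hr, preimage_mono <| subset_inter
    (TwistDatum.nhd_mono inter_subset_left (le_max_left ..))
    (TwistDatum.nhd_mono inter_subset_right (le_max_right ..))⟩

instance : TopologicalSpace (TwistedProduct D) := topologyOfNhdsOne (isBasis_nhd D).filter

section ContinuousMul

theorem one_le_filter_nhd : 1 ≤ (isBasis_nhd D).filter := by
  refine (isBasis_nhd D).hasBasis.ge_iff.2 fun q hq => mem_one.2 ?_
  exact TwistDatum.one_mem_nhd (mem_of_mem_nhds hq) q.2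

variable [ContinuousMul H]

theorem filter_nhd_mul_le : (isBasis_nhd D).filter * (isBasis_nhd D).filter ≤
    (isBasis_nhd D).filter := by
  refine (isBasis_nhd D).hasBasis.ge_iff.2 fun q hq => ?_
  obtain ⟨F, hF, hF_one, hFq⟩ := exists_open_nhds_one_mul_subset hq
  have nhd_mem : toProd D ⁻¹' D.nhd F (q.2 + 2) ∈ (isBasis_nhd D).filter :=
    (isBasis_nhd D).hasBasis.mem_of_mem (i := (F, q.2 + 2)) (hF.mem_nhds hF_one)
  refine mem_of_superset (Filter.mul_mem_mul nhd_mem nhd_mem) ?_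
  rintro _ ⟨x, hx, y, hy, rfl⟩
  exact TwistDatum.nhd_mul_nhd_subset hFq (mul_mem_mul hx hy)

theorem map_conj_filter_nhd_le (g : TwistedProduct D) :
    map (g * · * g⁻¹) (isBasis_nhd D).filter ≤ (isBasis_nhd D).filter := by
  refine (isBasis_nhd D).hasBasis.ge_iff.2 fun q hq => mem_map.2 ?_
  obtain ⟨a, ha⟩ := D.bijective_hom.2 (toProd D g).1
  have conj_mem : (a * · * a⁻¹) ⁻¹' q.1 ∈ 𝓝 (1 : H) :=
    (by fun_prop : Continuous (a * · * a⁻¹)).continuousAt.preimage_mem_nhds (by simpa using hq)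
  refine mem_of_superset ((isBasis_nhd D).hasBasis.mem_of_mem (i := (_, q.2)) conj_mem)
    fun p hp => ?_
  have := TwistDatum.conj_mem_nhd (F' := q.1) (fun x hx => hx) hp (toProd D g).2
  rwa [ha] at this

instance : ContinuousMul (TwistedProduct D) :=
  continuousMul_topologyOfNhdsOne one_le_filter_nhd filter_nhd_mul_le map_conj_filter_nhd_le

theorem hasBasis_nhds_one : (𝓝 (1 : TwistedProduct D)).HasBasis
    (fun q : Set H × ℕ => q.1 ∈ 𝓝 1) fun q => toProd D ⁻¹' D.nhd q.1 q.2 := by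
  rw [nhds_topologyOfNhdsOne one_le_filter_nhd filter_nhd_mul_le, one_smul]
  exact (isBasis_nhd D).hasBasis

variable [ContinuousMul K] [ContinuousMul L]

theorem continuous_toProd : Continuous (toProd D) := by
  refine continuous_of_tendsto_nhds_one (toProd D).toMonoidHom ?_
  rw [Prod.one_eq_mk, nhds_prod_eq]
  refine (D.isInvariantBasis.prod D.isAdapted.toHasAntitoneBasis).tendsto_right_iff.2 fun n _ => ?_
  have preimage_mem : D.hom ⁻¹' D.V (n + 1) ∈ 𝓝 1 :=
    D.continuous_hom.continuousAt.preimage_mem_nhds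
      (by simpa using D.isInvariantBasis.mem_nhds (n + 1))
  exact mem_of_superset (hasBasis_nhds_one.mem_of_mem (i := (_, n + 1)) preimage_mem)
    (preimage_mono (TwistDatum.nhd_preimage_subset n))

theorem t2Space [T2Space K] [T2Space L] : T2Space (TwistedProduct D) :=
  .of_injective_continuous (toProd D).injective continuous_toProd

theorem isFeeblyOpen_toProd [T2Space L] (hL : ¬ DiscreteTopology L) :
    IsFeeblyOpen (toProd D) := by
  refine isFeeblyOpen_of_nhds_one (toProd D).toMonoidHom fun U hU => ?_
  obtain ⟨q, hq, hqU⟩ := hasBasis_nhds_one.mem_iff.1 hU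
  have nhd_subset : D.nhd q.1 q.2 ⊆ toProd D '' U :=
    ((toProd D).surjective.image_preimage _).ge.trans (image_mono hqU)
  exact (TwistDatum.interior_nhd_nonempty hL (mem_of_mem_nhds hq) q.2).mono
    (interior_mono nhd_subset)

end ContinuousMul

section IsTopologicalGroup

variable [ContinuousMul H] [IsTopologicalGroup K] [IsTopologicalGroup L] [T2Space L]

theorem isSaturated (hL : ¬ DiscreteTopology L) : IsSaturated (TwistedProduct D) :=
  IsFeeblyOpen.isSaturated (L := K × L) (isFeeblyOpen_toProd hL) continuous_toProd

theorem reflexionTopology_eq (hL : ¬ DiscreteTopology L) :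
    reflexionTopology (TwistedProduct D) = .induced (toProd D) inferInstance :=
  IsFeeblyOpen.reflexionTopology_eq (L := K × L) (isFeeblyOpen_toProd hL) continuous_toProd

theorem isFlatClosed_preimage (hL : ¬ DiscreteTopology L) {s : Set (K × L)} (hs : IsClosed s) :
    IsFlatClosed (toProd D ⁻¹' s) := by
  rw [IsFlatClosed, reflexionTopology_eq hL]
  exact isClosed_induced_iff.2 ⟨s, hs, rfl⟩

-- `𝒢` need not respect isomorphisms, hence the two topologies on `K × L` are shown to be equal.
theorem class_reflexion_of_prod {𝒢 : ∀ (X : Type u) [Group X] [TopologicalSpace X], Prop}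
    (hL : ¬ DiscreteTopology L) (h𝒢 : 𝒢 (K × L)) : 𝒢 (Reflexion (TwistedProduct D)) := by
  have topology_eq : reflexionTopology (TwistedProduct D) = instTopologicalSpaceProd :=
    (reflexionTopology_eq hL).trans (induced_id (α := K × L))
  change @𝒢 (K × L) _ (reflexionTopology (TwistedProduct D))
  rwa [topology_eq]

theorem isFlatRegular (hL : ¬ DiscreteTopology L) : IsFlatRegular (TwistedProduct D) := by
  intro U hU
  obtain ⟨q, hq, hqU⟩ := hasBasis_nhds_one.mem_iff.1 hU
  refine ⟨toProd D ⁻¹' closure (D.nhd q.1 (q.2 + 2)), ?_,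
    (preimage_mono TwistDatum.closure_nhd_subset).trans hqU,
    isFlatClosed_preimage hL isClosed_closure⟩
  exact mem_of_superset (hasBasis_nhds_one.mem_of_mem (i := (q.1, q.2 + 2)) hq)
    (preimage_mono subset_closure)

end IsTopologicalGroup

section Slice

/-- The slice `K × {1}`, parametrized by `H`. -/
def slice (D : TwistDatum H K L) : H →* TwistedProduct D :=
  (toProd D).symm.toMonoidHom.comp ((MonoidHom.inl K L).comp D.hom)

/-- The projection of the twisted product onto `L`. -/
def sndHom (D : TwistDatum H K L) : TwistedProduct D →* L :=
  (MonoidHom.snd K L).comp (toProd D).toMonoidHom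

theorem range_slice : (slice D).range = (sndHom D).ker := by
  ext p
  rw [MonoidHom.mem_ker]
  constructor
  · rintro ⟨x, rfl⟩
    rfl
  · intro hp
    obtain ⟨x, hx⟩ := D.bijective_hom.2 (toProd D p).1
    exact ⟨x, (toProd D).injective (Prod.ext hx hp.symm)⟩

theorem mk_quotient_range_slice : #(TwistedProduct D ⧸ (slice D).range) = #L := by
  rw [range_slice]
  exact mk_congr (QuotientGroup.quotientKerEquivOfSurjective (sndHom D) fun b =>
    ⟨(toProd D).symm (1, b), rfl⟩).toEquiv

theorem isFlatClosed_range_slice [ContinuousMul H] [IsTopologicalGroup K] [IsTopologicalGroup L]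
    [T2Space L] (hL : ¬ DiscreteTopology L) :
    IsFlatClosed ((slice D).range : Set (TwistedProduct D)) := by
  rw [range_slice]
  exact isFlatClosed_preimage hL (isClosed_singleton.preimage continuous_snd)

theorem isEmbedding_slice [ContinuousMul H] [IsTopologicalGroup K] (hD : IsRegularMap D.hom) :
    IsEmbedding (slice D) := by
  refine ⟨isInducing_of_nhds_one_eq_comap (slice D) (le_antisymm ?_ fun U hU => ?_),
    fun x y hxy => D.bijective_hom.1 (congrArg (fun p => (toProd D p).1) hxy)⟩
  · refine (hasBasis_nhds_one.comap _).ge_iff.2 fun q hq => mem_of_superset hq fun x hx => ?_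
    refine ⟨(TwistDatum.one_mem_nhd (mem_of_mem_nhds hq) q.2).1, fun k _ => ?_⟩
    exact ⟨_, ⟨x, hx, rfl⟩, 1, D.isInvariantBasis.one_mem _, mul_one _⟩
  · obtain ⟨A, hA, -, hA_nhds, hAU⟩ := hD 1 U hU
    refine (hasBasis_nhds_one.comap _).mem_iff.2 ⟨(D.hom ⁻¹' A, 0), hA_nhds, fun x hx => hAU ?_⟩
    refine hA.closure_subset (mem_closure_iff_nhds_one.2 fun W hW => ?_)
    obtain ⟨k, hk⟩ := D.isInvariantBasis.mem_iff.1 (inv_mem_nhds_one K hW)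
    obtain ⟨_, ⟨f, hf, rfl⟩, v, hv, hfv⟩ := hx.2 k (D.isAdapted.one_mem k)
    refine ⟨D.hom f, hf, ?_⟩
    have hx_eq : D.hom x = D.hom f * v := hfv.symm
    have div_eq : D.hom f / D.hom x = (D.hom f * v * (D.hom f)⁻¹)⁻¹ := by
      simp [hx_eq, div_eq_mul_inv, mul_assoc]
    exact div_eq ▸ hk (D.isInvariantBasis.isConjInvariant _ (D.hom f) v hv)

end Slice

end TwistedProduct

section Character

theorem character_spec (X : Type u) [TopologicalSpace X] : ℵ₀ ≤ character X ∧
    ∀ x : X, ∃ B : Set (Set X), #B ≤ character X ∧ (𝓝 x).HasBasis (· ∈ B) id :=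
  csInf_mem (s := {κ : Cardinal.{u} | ℵ₀ ≤ κ ∧
      ∀ x : X, ∃ B : Set (Set X), #B ≤ κ ∧ (𝓝 x).HasBasis (· ∈ B) id})
    ⟨max ℵ₀ #(Set X), le_max_left _ _, fun x =>
      ⟨{s | s ∈ 𝓝 x}, (mk_set_le _).trans (le_max_right _ _), (𝓝 x).basis_sets⟩⟩

theorem character_le {X : Type u} [TopologicalSpace X] {κ : Cardinal.{u}} (hκ : ℵ₀ ≤ κ)
    (h : ∀ x : X, ∃ B : Set (Set X), #B ≤ κ ∧ (𝓝 x).HasBasis (· ∈ B) id) : character X ≤ κ :=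
  csInf_le' ⟨hκ, h⟩

theorem character_le_of_isInducing {X Y : Type u} [TopologicalSpace X] [TopologicalSpace Y]
    {f : X → Y} (hf : IsInducing f) : character X ≤ character Y := by
  refine character_le (character_spec Y).1 fun x => ?_
  obtain ⟨B, hB_card, hB⟩ := (character_spec Y).2 (f x)
  refine ⟨(f ⁻¹' ·) '' B, mk_image_le.trans hB_card, ⟨fun s => ?_⟩⟩
  simp [hf.nhds_eq_comap, (hB.comap f).mem_iff]

theorem character_le_of_hasBasis_nhds_one {G : Type u} [Group G] [TopologicalSpace G]
    [ContinuousMul G] {ι : Type u} {s : ι → Set G} (hs : (𝓝 1).HasBasis (fun _ => True) s) :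
    character G ≤ max ℵ₀ #ι := by
  refine character_le (le_max_left _ _) fun a => ?_
  refine ⟨range fun i => (a⁻¹ * ·) ⁻¹' s i, mk_range_le.trans (le_max_right _ _), ⟨fun t => ?_⟩⟩
  simp [nhds_eq_comap_inv_mul a, (hs.comap (a⁻¹ * ·)).mem_iff]

theorem TwistedProduct.character_eq {H K L : Type u} [Group H] [TopologicalSpace H]
    [ContinuousMul H] [Group K] [TopologicalSpace K] [IsTopologicalGroup K] [Group L]
    [TopologicalSpace L] {D : TwistDatum H K L} (hD : IsRegularMap D.hom) :
    character (TwistedProduct D) = character H := by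
  refine le_antisymm ?_ (character_le_of_isInducing (isEmbedding_slice hD).isInducing)
  obtain ⟨aleph0_le, exists_basis⟩ := character_spec H
  obtain ⟨B, hB_card, hB⟩ := exists_basis 1
  have basis : (𝓝 (1 : TwistedProduct D)).HasBasis (fun _ : B × ULift.{u} ℕ => True)
      fun q => toProd D ⁻¹' D.nhd q.1 q.2.down := by
    refine ⟨fun s => hasBasis_nhds_one.mem_iff.trans ⟨?_, ?_⟩⟩
    · rintro ⟨q, hq, hqs⟩
      obtain ⟨F, hF, hFq⟩ := hB.mem_iff.1 hq
      exact ⟨(⟨F, hF⟩, ⟨q.2⟩), trivial,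
        (preimage_mono (TwistDatum.nhd_mono hFq le_rfl)).trans hqs⟩
    · rintro ⟨q, -, hqs⟩
      exact ⟨(q.1, q.2.down), hB.mem_of_mem q.1.2, hqs⟩
  calc character (TwistedProduct D) ≤ max ℵ₀ #(B × ULift.{u} ℕ) :=
        character_le_of_hasBasis_nhds_one basis
    _ ≤ max ℵ₀ (character H * ℵ₀) := by
        gcongr
        simpa using mul_le_mul_left hB_card ℵ₀
    _ = character H := by rw [mul_aleph0_eq aleph0_le, max_eq_right aleph0_le]

end Character

section Reduction

variable {G H : Type u} [Group G] [TopologicalSpace G] [ContinuousMul G]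

theorem IsFlatRegular.exists_isClosed_preimage (hG : IsFlatRegular G) (a : G) {U : Set G}
    (hU : U ∈ 𝓝 a) :
    ∃ F : Set (Reflexion G), IsClosed F ∧ toReflexion G ⁻¹' F ∈ 𝓝 a ∧ toReflexion G ⁻¹' F ⊆ U := by
  obtain ⟨F, hF, hFU, hF_closed⟩ := hG (a⁻¹ • U) (by simpa using smul_mem_nhds_smul a⁻¹ hU)
  have F_isClosed : IsClosed (toReflexion G '' F) := by
    rwa [show toReflexion G '' F = F from image_id _]
  refine ⟨toReflexion G a • toReflexion G '' F, F_isClosed.smul _, ?_⟩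
  have preimage_eq : toReflexion G ⁻¹' (toReflexion G a • toReflexion G '' F) = a • F := by
    rw [← image_smul_distrib, (toReflexion G).injective.preimage_image]
  rw [preimage_eq]
  exact ⟨smul_mem_nhds_self.2 hF, smul_set_subset_iff_subset_inv_smul_set.2 hFU⟩

theorem isClassRegular_of_isEmbedding {𝒢 : ∀ (X : Type u) [Group X] [TopologicalSpace X], Prop}
    (h𝒢 : IsClosedHereditary 𝒢) (hG : IsFlatRegular G) (hG𝒢 : 𝒢 (Reflexion G)) [Group H]
    [TopologicalSpace H] (i : H →* G) (hi : IsEmbedding i)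
    (hi_closed : IsFlatClosed (i.range : Set G)) : IsClassRegular 𝒢 H := by
  let j : H →* Reflexion G := (toReflexion G).toMonoidHom.comp i
  have j_cont : Continuous j.rangeRestrict :=
    (continuous_toReflexion.comp hi.continuous).subtype_mk _
  refine ⟨j.range, inferInstance, inferInstance, j.rangeRestrict,
    h𝒢 (Reflexion G) hG𝒢 j.range hi_closed, j_cont,
    ⟨fun x y hxy => hi.injective (congrArg Subtype.val hxy), j.rangeRestrict_surjective⟩,
    fun x U hU => ?_⟩
  rw [hi.nhds_eq_comap] at hU
  obtain ⟨U', hU', hU'U⟩ := hU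
  obtain ⟨F, hF, hFx, hFU'⟩ := hG.exists_isClosed_preimage (i x) hU'
  have F_closed : IsClosed ((↑) ⁻¹' F : Set j.range) := hF.preimage continuous_subtype_val
  exact ⟨_, F_closed, F_closed.preimage j_cont, hi.continuous.continuousAt hFx,
    (preimage_mono hFU').trans hU'U⟩

end Reduction

section Construction

variable {T H K : Type u} [Group T] [TopologicalSpace T] [ContinuousMul T]
  [Group H] [TopologicalSpace H] [Group K] [TopologicalSpace K]

theorem IsSorgenfrey.exists_twistDatum [FirstCountableTopology (Reflexion T)]
    [ContinuousMul K] [FirstCountableTopology K] (hT : IsSorgenfrey T) (hT_sin : IsSIN T)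
    (hL : IsSIN (Reflexion T)) (hK : IsSIN K) (h : H →* K) (h_cont : Continuous h)
    (h_bij : Bijective h) : ∃ D : TwistDatum H K (Reflexion T), D.hom = h := by
  obtain ⟨C, hC⟩ := hT.exists_isSorgenfreyCone hT_sin
  obtain ⟨V, hV⟩ := hK.exists_isInvariantBasis
  obtain ⟨N, hN⟩ := hC.closure.exists_isAdapted hL
  exact ⟨⟨h, V, closure C, N, h_cont, h_bij, hV, hC.closure, isClosed_closure, hN⟩, rfl⟩

end Construction

end Paratop

theorem theorem2_general
    (T : Type u) [Group T] [TopologicalSpace T] [ContinuousMul T]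
    (hTsor : IsSorgenfrey T) (hTsin : IsSIN T)
    (𝒢 : ∀ (X : Type u) [Group X] [TopologicalSpace X], Prop)
    (h𝒢 : IsClassOfFirstCountableSINGroups 𝒢)
    (h𝒢closed : IsClosedHereditary 𝒢)
    (h𝒢stable : IsStable 𝒢 (Reflexion T))
    (H : Type u) [Group H] [TopologicalSpace H] [ContinuousMul H] :
    IsClassRegular 𝒢 H ↔
      ∃ (G : Type u) (_ : Group G) (_ : TopologicalSpace G) (_ : ContinuousMul G)
        (_ : T2Space G) (i : H →* G),
        IsEmbedding i ∧ IsFlatClosed (i.range : Set G) ∧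
        IsSaturated G ∧ IsFlatRegular G ∧ 𝒢 (Reflexion G) ∧
        character G = character H ∧ #(G ⧸ i.range) = #T := by
  constructor
  · rintro ⟨K, _, _, h, hK, h_cont, h_bij, h_reg⟩
    obtain ⟨_, _, _, hK_sin⟩ := h𝒢 K hK
    obtain ⟨-, _, _, prod_sin⟩ := h𝒢 _ (h𝒢stable K hK)
    have inr_emb : IsEmbedding (MonoidHom.inr K (Reflexion T)) := isEmbedding_prodMkRight 1
    have : T2Space (Reflexion T) := inr_emb.t2Space
    have : FirstCountableTopology (Reflexion T) := inr_emb.isInducing.firstCountableTopology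
    have not_discrete := not_discreteTopology_reflexion hTsor.1
    obtain ⟨D, rfl⟩ := hTsor.exists_twistDatum hTsin (prod_sin.of_isInducing _ inr_emb.isInducing)
      hK_sin h h_cont h_bij
    exact ⟨TwistedProduct D, inferInstance, inferInstance, inferInstance, TwistedProduct.t2Space,
      TwistedProduct.slice D, TwistedProduct.isEmbedding_slice h_reg,
      TwistedProduct.isFlatClosed_range_slice not_discrete, TwistedProduct.isSaturated not_discrete,
      TwistedProduct.isFlatRegular not_discrete,
      TwistedProduct.class_reflexion_of_prod not_discrete (h𝒢stable K hK),
      TwistedProduct.character_eq h_reg, TwistedProduct.mk_quotient_range_slice⟩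
  · rintro ⟨G, _, _, _, _, i, hi, hi_closed, -, hG, hG𝒢, -, -⟩
    exact isClassRegular_of_isEmbedding h𝒢closed hG hG𝒢 i hi hi_closed

theorem theorem2
    (T : Type u) [Group T] [TopologicalSpace T] [ContinuousMul T] [T2Space T]
    [FirstCountableTopology T] [RegularSpace T]
    (hTsat : IsSaturated T) (hTsor : IsSorgenfrey T) (hTsin : IsSIN T)
    (𝒢 : ∀ (X : Type u) [Group X] [TopologicalSpace X], Prop)
    (h𝒢 : IsClassOfFirstCountableSINGroups 𝒢)
    (h𝒢closed : IsClosedHereditary 𝒢)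
    (h𝒢stable : IsStable 𝒢 (Reflexion T))
    (H : Type u) [Group H] [TopologicalSpace H] [ContinuousMul H] [T2Space H] :
    IsClassRegular 𝒢 H ↔
      ∃ (G : Type u) (_ : Group G) (_ : TopologicalSpace G) (_ : ContinuousMul G)
        (_ : T2Space G) (i : H →* G),
        IsEmbedding i ∧ IsFlatClosed (i.range : Set G) ∧
        IsSaturated G ∧ IsFlatRegular G ∧ 𝒢 (Reflexion G) ∧
        character G = character H ∧ #(G ⧸ i.range) = #T :=
  theorem2_general T hTsor hTsin 𝒢 h𝒢 h𝒢closed h𝒢stable H
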